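/- Let $G=(V,E)$ be a finite loopless multigraph, $\mathbb E$ its set of oriented edges ($e=uv$ has tail $u$, head $v$ and reverse $\bar e$), $\ell:E\to\mathbb Z_{>0}$ an edge length function and $\mathfrak m\in C^1(G,\mathbb Z)$. Here $C^0(G,A)$ is the module of functions $V\to A$ and $C^1(G,A)$ that of functions $x:\mathbb E\to A$ with $x(\bar e)=-x(e)$; $d(f)(uv)=f(v)-f(u)$; $d^*(x)(v)=\sum_{e\text{ with head }v}x(e)$; $\langle x,y\rangle=\frac12\sum_{e\in\mathbb E}x(e)y(e)$. For $f\in C^0(G,\mathbb Z)$ and $e=uv\in\mathbb E$ put $\delta^{\mathfrak m}_e(f)=\lfloor (f(v)-f(u)+\mathfrak m_e)/\ell_e\rfloor$ and $\mathfrak d^{\mathfrak m}_f(e)=\frac12(\delta^{\mathfrak m}_e(f)-\delta^{\mathfrak m}_{\bar e}(f))$. Let $G^{\mathfrak m}_f$ be the spanning subgraph of $G$ formed by the edges $e=uv$ with $\ell_e\mid f(v)-f(u)+\mathfrak m_e$. Let $\square^{\mathfrak m}_f$ be the set of all $\mathfrak d^{\mathfrak m}_f+\epsilon$ with $\epsilon\in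 C^1(G,\mathbb R)$, $\|\epsilon\|_\infty\le\frac12$ and $\epsilon=0$ off $G^{\mathfrak m}_f$, and let $\mathrm{Vor}^{\mathfrak m}_H(f)=d^*(\square^{\mathfrak m}_f)$, a polytope. Faces and orientations. Suppose that $G':=G^{\mathfrak m}_f$ is connected. A bond element of $G'$ is an element $\beta=d_{G'}(\chi_S)$ of $C^1(G',\mathbb R)$, where $S\subseteq V$ is such that the subgraphs of $G'$ induced on $S$ and on $V-S$ are both (non-empty and) connected. Put $F_\beta=\{x\in \mathrm{Im}(d_{G'}) : 2\langle x,\beta\rangle=\langle\beta,\beta\rangle\}$. To a non-empty face $\mathfrak f$ of $\mathrm{Vor}^{\mathfrak m}_H(f)$ (the polytope itself included) associate the set $\phi(\mathfrak f)$ of oriented edges of $G'$ on which $\beta$ is positive for some bond element $\beta$ of $G'$ with $\mathfrak f\subseteq d^*(\mathfrak d^{\mathfrak m}_f)+d^*_{G'}(F_\beta)$. The face corresponding to an orientation $D$ of a subgraph of $G'$ is the face $\mathfrak f$ with $\phi(\mathfrak f)=D$. Let $f_1,f_2\in C^0(G,\mathbb Z)$, and let $X_1,\dots,X_q\subseteq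 V$ be the level subsets of $f_2-f_1$, in increasing order. Let $D_1$ be the coherent acyclic orientation of the cut subgraph of $G^{\mathfrak m}_{f_1}$ induced by the ordered partition $X_1,\dots,X_q$ (it consists of all the oriented edges $uv$ of $G^{\mathfrak m}_{f_1}$ with $u\in X_i$, $v\in X_j$, $i<j$), and let $D_2$ be that of the cut subgraph of $G^{\mathfrak m}_{f_2}$ induced by the reversed ordered partition $X_q,\dots,X_1$. Let $\chi_{D_i}\in C^1(G,\mathbb R)$ take value $1$ at $e\in D_i$, $-1$ at $e$ with $\bar e\in D_i$, and $0$ elsewhere. Then $$\mathrm{Vor}^{\mathfrak m}_H(f_1)\cap\mathrm{Vor}^{\mathfrak m}_H(f_2)\ne\emptyset\iff \mathfrak d^{\mathfrak m}_{f_1}+\tfrac12\chi_{D_1}=\mathfrak d^{\mathfrak m}_{f_2}+\tfrac12\chi_{D_2}.$$ Furthermore, in this case, if $G^{\mathfrak m}_{f_1}$ and $G^{\mathfrak m}_{f_2}$ are connected, there are a unique face $\mathfrak f_1$ of $\mathrm{Vor}^{\mathfrak m}_H(f_1)$ corresponding to $D_1$ and a unique face $\mathfrak f_2$ of $\mathrm{Vor}^{\mathfrak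 m}_H(f_2)$ corresponding to $D_2$, and $$\mathfrak f_1=\mathfrak f_2=\mathrm{Vor}^{\mathfrak m}_H(f_1)\cap\mathrm{Vor}^{\mathfrak m}_H(f_2).$$ -/

import Mathlib

open scoped Graph

namespace VorTiling

universe u v

variable {α : Type u} {β : Type v}

/-- The oriented edges of a multigraph: an edge together with an ordering `(fst, snd)` of its two
ends; it is oriented from its tail `fst` to its head `snd`. -/
@[ext]
structure Dart (G : Graph α β) where
  edge : β
  fst : α
  snd : α
  isLink : G.IsLink edge fst snd

/-- The tail of an oriented edge. -/
def Dart.tail {G : Graph α β} (a : Dart G) : V(G) := ⟨a.fst, a.isLink.left_mem⟩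

/-- The head of an oriented edge. -/
def Dart.head {G : Graph α β} (a : Dart G) : V(G) := ⟨a.snd, a.isLink.right_mem⟩

/-- The same edge with the reverse orientation. -/
def Dart.rev {G : Graph α β} (a : Dart G) : Dart G := ⟨a.edge, a.snd, a.fst, a.isLink.symm⟩

@[simp] theorem Dart.rev_rev {G : Graph α β} (a : Dart G) : a.rev.rev = a := rfl

@[simp] theorem Dart.tail_rev {G : Graph α β} (a : Dart G) : a.rev.tail = a.head := rfl

@[simp] theorem Dart.head_rev {G : Graph α β} (a : Dart G) : a.rev.head = a.tail := rfl

/-- An oriented edge of a subgraph, viewed in the graph. -/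
def Dart.ofLE {G' G : Graph α β} (h : G' ≤ G) (a : Dart G') : Dart G :=
  ⟨a.edge, a.fst, a.snd, h.isLink_mono a.isLink⟩

instance instFiniteDart [Finite α] [Finite β] (G : Graph α β) : Finite (Dart G) :=
  Finite.of_injective (fun a : Dart G => (a.edge, a.fst, a.snd)) fun a b h => by
    simp only [Prod.mk.injEq] at h
    exact Dart.ext h.1 h.2.1 h.2.2

noncomputable instance instFintypeDart [Finite α] [Finite β] (G : Graph α β) :
    Fintype (Dart G) := Fintype.ofFinite _

/-- `C⁰(G, A)`. -/
abbrev C0 (G : Graph α β) (A : Type*) := V(G) → A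

/-- `C¹(G, A)`: the functions on the oriented edges that change sign when the edge is reversed. -/
def C1 (G : Graph α β) (A : Type*) [CommRing A] : Submodule A (Dart G → A) where
  carrier := {x | ∀ a, x a.rev = - x a}
  add_mem' hx hy a := by simp [hx a, hy a, add_comm]
  zero_mem' a := by simp
  smul_mem' c x hx a := by simp [hx a]

/-- The coboundary `d : C⁰(G, A) → C¹(G, A)`. -/
def d (G : Graph α β) (A : Type*) [CommRing A] : C0 G A →ₗ[A] C1 G A where
  toFun f := ⟨fun a => f a.head - f a.tail, fun a => by simp⟩
  map_add' f g := by ext a; simp; ring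
  map_smul' c f := by ext a; simp; ring

open Classical in
/-- The map `d* : C¹(G, A) → C⁰(G, A)`, adjoint to `d`: its value at a vertex `v` is the sum of the
values on the oriented edges with head `v`. -/
noncomputable def dStar [Finite α] [Finite β] (G : Graph α β) (A : Type*) [CommRing A]
    (x : C1 G A) : C0 G A :=
  fun v => ∑ a : Dart G, if a.head = v then x.1 a else 0

/-- The scalar product on `C¹(G, ℝ)`, one summand for each unoriented edge (every loopless edge
occurs with its two orientations in the sum below, with equal contributions). -/
noncomputable def inner1 [Finite α] [Finite β] (G : Graph α β) (x y : C1 G ℝ) : ℝ :=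
  (1 / 2) * ∑ a : Dart G, x.1 a * y.1 a

/-- The cut space `F_ℝ`. -/
def cutSpace (G : Graph α β) : Submodule ℝ (C1 G ℝ) := LinearMap.range (d G ℝ)

/-- Connectedness of a multigraph. -/
def Connected (G : Graph α β) : Prop := G.toSimpleGraph.Connected

/-- The bond elements: the cut elements `d(χ_S)` such that the induced subgraphs on `S` and on its
complement are both connected (in particular non-empty). -/
def IsBondElement (G : Graph α β) (b : C1 G ℝ) : Prop :=
  ∃ S : Set V(G), (G.toSimpleGraph.induce S).Connected ∧ (G.toSimpleGraph.induce Sᶜ).Connected ∧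
    b = d G ℝ (S.indicator fun _ => 1)

/-- The positive support. -/
def suppPos (G : Graph α β) (x : C1 G ℝ) : Set (Dart G) := {a | 0 < x.1 a}

/-- The hyperplane `2⟨x, b⟩ = ‖b‖²` of the cut space. -/
def bondHyperplane [Finite α] [Finite β] (G : Graph α β) (b : C1 G ℝ) : Set (C1 G ℝ) :=
  {x | x ∈ cutSpace G ∧ 2 * inner1 G x b = inner1 G b b}

/-- The coherent acyclic orientation of a cut subgraph of `G` given by an ordered partition of the
vertices. The ordered partition is given by a map `p` to a totally ordered set: its parts are the
non-empty fibres of `p`, ordered by the value of `p`. The edges between different parts are kept,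
and oriented from the smaller part to the larger one. -/
def coherentOrientation (G : Graph α β) {I : Type*} [LinearOrder I] (p : V(G) → I) :
    Set (Dart G) :=
  {a | p a.tail < p a.head}

open Classical in
/-- The characteristic function of a set `D` of oriented edges: `1` at `a ∈ D`, `-1` at `a` with
reverse in `D`, and `0` elsewhere (for `D` not containing an oriented edge with its reverse). -/
noncomputable def charFun (G : Graph α β) (D : Set (Dart G)) : C1 G ℝ :=
  ⟨fun a => (if a ∈ D then 1 else 0) - (if a.rev ∈ D then 1 else 0), fun _ =>
    (neg_sub _ _).symm⟩

section Twisted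

variable (G : Graph α β) (ℓ : β → ℕ) (m : C1 G ℤ) (f : C0 G ℤ)

/-- `δᵐ_a(f) = ⌊(f(v) - f(u) + m_a) / ℓ_a⌋` for an oriented edge `a = uv`. -/
noncomputable def delta (a : Dart G) : ℤ :=
  ⌊((f a.head - f a.tail + m.1 a : ℤ) : ℝ) / (ℓ a.edge : ℝ)⌋

/-- The point `𝔡ᵐ_f`, with value `(δᵐ_a(f) - δᵐ_ā(f)) / 2` at `a`. -/
noncomputable def dPoint : C1 G ℝ :=
  ⟨fun a => (1 / 2) * ((delta G ℓ m f a : ℝ) - (delta G ℓ m f a.rev : ℝ)), fun a => by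
    simp only [Dart.rev_rev]; ring⟩

/-- The spanning subgraph `Gᵐ_f`: its edges are those for which `ℓ_a ∣ f(v) - f(u) + m_a`,
for one (equivalently, for each) orientation `a = uv` of the edge. -/
def subgraph : Graph α β :=
  G.restrict {e | ∃ a : Dart G, a.edge = e ∧ (ℓ e : ℤ) ∣ f a.head - f a.tail + m.1 a}

theorem subgraph_le : subgraph G ℓ m f ≤ G := G.restrict_le

theorem vertexSet_subgraph : V(subgraph G ℓ m f) = V(G) := rfl

/-- The cube `□ᵐ_f`. -/
def cube : Set (C1 G ℝ) :=
  {x | ∃ ε : C1 G ℝ, (∀ a, |ε.1 a| ≤ 1 / 2) ∧ (∀ a, a.edge ∉ E(subgraph G ℓ m f) → ε.1 a = 0) ∧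
    x = dPoint G ℓ m f + ε}

/-- The polytope `Vorᵐ_H(f) = d*(□ᵐ_f)`. -/
def vor [Finite α] [Finite β] : Set (C0 G ℝ) := dStar G ℝ '' cube G ℓ m f

/-- The affine hyperplane of `H_{0,ℝ}` which corresponds to a bond element `b` of `Gᵐ_f`: the image
of the hyperplane `2⟨x, b⟩ = ‖b‖²` of the cut space of `Gᵐ_f` by `d*` of `Gᵐ_f`, translated to the
centre `d*(𝔡ᵐ_f)` of `Vorᵐ_H(f)`. Note that `C⁰(Gᵐ_f, ℝ) = C⁰(G, ℝ)`. -/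
def vorHyperplane [Finite α] [Finite β] (b : C1 (subgraph G ℓ m f) ℝ) : Set (C0 G ℝ) :=
  (fun x v => dStar G ℝ (dPoint G ℓ m f) v + dStar (subgraph G ℓ m f) ℝ x v) ''
    bondHyperplane (subgraph G ℓ m f) b

/-- The orientation `φ(𝔣)` attached to a face `𝔣` of `Vorᵐ_H(f)`: the union of the positive
supports of all the bond elements of `Gᵐ_f` whose hyperplane contains `𝔣`. -/
def faceOrientation [Finite α] [Finite β] (F : Set (C0 G ℝ)) :
    Set (Dart (subgraph G ℓ m f)) :=
  ⋃ b ∈ {b | IsBondElement (subgraph G ℓ m f) b ∧ F ⊆ vorHyperplane G ℓ m f b},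
    suppPos (subgraph G ℓ m f) b

/-- `F` is the face of `Vorᵐ_H(f)` which corresponds to `D`: a non-empty exposed face (the polytope
itself is allowed) with `φ(F) = D`. -/
def IsFaceOf [Finite α] [Finite β] (D : Set (Dart (subgraph G ℓ m f))) (F : Set (C0 G ℝ)) : Prop :=
  F.Nonempty ∧ IsExposed ℝ (vor G ℓ m f) F ∧ faceOrientation G ℓ m f F = D

/-- The characteristic function in `C¹(G, ℝ)` of a set of oriented edges of `Gᵐ_f`. -/
noncomputable def chi (D : Set (Dart (subgraph G ℓ m f))) : C1 G ℝ :=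
  charFun G (Dart.ofLE (subgraph_le G ℓ m f) '' D)

end Twisted

/-- The orientation `D₁` of a cut subgraph of `Gᵐ_{f₁}` induced by the level sets of `f₂ - f₁`, in
increasing order. -/
def orientationIncr (G : Graph α β) (ℓ : β → ℕ) (m : C1 G ℤ) (f₁ f₂ : C0 G ℤ) :
    Set (Dart (subgraph G ℓ m f₁)) :=
  coherentOrientation (subgraph G ℓ m f₁) (f₂ - f₁ : C0 G ℤ)

/-- The orientation `D₂` of a cut subgraph of `Gᵐ_{f₂}` induced by the level sets of `f₂ - f₁`, in
the reverse order. -/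
def orientationDecr (G : Graph α β) (ℓ : β → ℕ) (m : C1 G ℤ) (f₁ f₂ : C0 G ℤ) :
    Set (Dart (subgraph G ℓ m f₂)) :=
  coherentOrientation (subgraph G ℓ m f₂) fun v => OrderDual.toDual ((f₂ - f₁ : C0 G ℤ) v)

end VorTiling

/-! The cube of `f` consists of the cochains `x` with `x(a) ≤ δ_a(f) + 1/2` for every oriented edge
`a` (`mem_cube_iff`). As `d*` is adjoint to `d`, a functional with coefficients `g` on the polytope
pulls back to `⟨x, d g⟩`, which is maximised edge by edge: the exposed faces are the images `faceSet
g` of the cochains attaining the bound on all `a` along which `g` increases.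

Now take `g = f₂ - f₁`. Where `g` increases, `δ_a(f₁) + δ_ā(f₂) ≤ -1`, so the upper bound of the
first cube at `a` is at most the lower bound of the second. Hence `g` weakly separates the
polytopes, and a common point forces equality on all these edges. That equality is the displayed
identity (`extremePoint_eq_iff`), whose two sides lie in the respective cubes; the intersection is
then the face of the first polytope where `g` is maximal and, by symmetry, the face of the second
where `-g` is.

Orientations identify these faces: `faceSet g` lies in the hyperplane of a cut iff `g` increases
along all its edges, and in a connected graph each edge along which `g` increases lies in such a
bond. So `φ(faceSet g)` is the coherent orientation of `g`, which in turn determines `faceSet g`. -/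

namespace SimpleGraph

/-! ### Bonds in connected graphs -/

variable {V : Type*} (H : SimpleGraph V)

/-- The connected component of `v` in the subgraph of `H` induced on `T`, as a set of vertices
of `H`. -/
def componentIn (T : Set V) (v : V) : Set V :=
  {w | ∃ p : H.Walk v w, ∀ x ∈ p.support, x ∈ T}

variable {H} {T : Set V} {v w : V}

theorem mem_componentIn_self (hv : v ∈ T) : v ∈ H.componentIn T v :=
  ⟨Walk.nil, by simpa using hv⟩

theorem componentIn_subset : H.componentIn T v ⊆ T :=
  fun _ ⟨p, hp⟩ => hp _ p.end_mem_support

theorem mem_componentIn_of_adj {x y : V} (hx : x ∈ H.componentIn T v) (h : H.Adj x y)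
    (hy : y ∈ T) : y ∈ H.componentIn T v := by
  obtain ⟨p, hp⟩ := hx
  refine ⟨p.concat h, fun z hz => ?_⟩
  rw [Walk.support_concat, List.mem_append, List.mem_singleton] at hz
  rcases hz with hz | rfl
  exacts [hp z hz, hy]

theorem connected_induce_componentIn (hv : v ∈ T) : (H.induce (H.componentIn T v)).Connected := by
  classical
  refine H.induce_connected_of_patches v (mem_componentIn_self hv) ?_
  rintro w ⟨p, hp⟩
  refine ⟨{x | x ∈ p.support}, fun x hx => ⟨p.takeUntil x hx, fun z hz => hp z ?_⟩,
    p.start_mem_support, p.end_mem_support, p.connected_induce_support _ _⟩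
  exact p.support_takeUntil_subset_support hx hz

/-- The complement of a component of the complement of a connected set is connected. -/
theorem connected_induce_compl_componentIn (hH : H.Connected) {C : Set V}
    (hC : (H.induce C).Connected) (u : V) : (H.induce (H.componentIn Cᶜ u)ᶜ).Connected := by
  set K := H.componentIn Cᶜ u with hK
  obtain ⟨⟨v, hv⟩⟩ := hC.nonempty
  have hCK : C ⊆ Kᶜ := fun x hx hxK => componentIn_subset hxK hx
  -- Follow a walk towards `v ∈ C`. Before reaching `C` it cannot enter the component `K` from
  -- outside; once in `C`, connectedness of `C` finishes.
  have key : ∀ (w : V) (p : H.Walk w v) (hw : w ∈ Kᶜ),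
      (H.induce Kᶜ).Reachable ⟨w, hw⟩ ⟨v, hCK hv⟩ := by
    intro w p
    induction p with
    | nil => intro hw; exact Reachable.refl _
    | @cons w w' _ h p ih =>
      intro hw
      by_cases hwC : w ∈ C
      · exact (hC.preconnected ⟨w, hwC⟩ ⟨_, hv⟩).map (induceHomOfLE H hCK).toHom
      · have hw' : w' ∈ Kᶜ := fun h' => hw (mem_componentIn_of_adj h' h.symm hwC)
        have hadj : (H.induce Kᶜ).Adj ⟨w, hw⟩ ⟨w', hw'⟩ := h
        exact hadj.reachable.trans (ih hv hw')
  rw [connected_iff_exists_forall_reachable]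
  exact ⟨⟨v, hCK hv⟩, fun ⟨w, hw⟩ => (key w (hH.preconnected w v).some hw).symm⟩

/-- In a connected graph, an edge along which `g` increases lies in a bond all of whose edges are
traversed by `g` in the same direction. -/
theorem exists_increasing_bond (hH : H.Connected) {R : Type*} [LinearOrder R] (g : V → R)
    {u v : V} (hg : g u < g v) :
    ∃ S : Set V, (H.induce S).Connected ∧ (H.induce Sᶜ).Connected ∧ u ∉ S ∧ v ∈ S ∧
      ∀ x y, H.Adj x y → x ∉ S → y ∈ S → g x < g y := by
  have hv : v ∈ {x | g v ≤ g x} := le_refl (g v)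
  set C := H.componentIn {x | g v ≤ g x} v with hCdef
  have hC : (H.induce C).Connected := connected_induce_componentIn hv
  have huC : u ∈ Cᶜ := fun h => not_le.mpr hg (componentIn_subset (T := {x | g v ≤ g x}) h)
  -- An edge leaving the component of `u` in `Cᶜ` must end in `C`, where `g ≥ g v`; its other end is
  -- outside `C`, so `g < g v` there by maximality of `C`.
  refine ⟨(H.componentIn Cᶜ u)ᶜ, connected_induce_compl_componentIn hH hC u, ?_,
    fun h => h (mem_componentIn_self huC),
    fun h => componentIn_subset h (mem_componentIn_self hv), ?_⟩
  · rw [compl_compl]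
    exact connected_induce_componentIn huC
  · intro x y hxy hx hy
    rw [Set.notMem_compl_iff] at hx
    have hyC : y ∈ C := by
      by_contra hyC
      exact hy (mem_componentIn_of_adj hx hxy hyC)
    have hxC : x ∉ C := componentIn_subset hx
    have hxT : ¬ g v ≤ g x := fun h => hxC (mem_componentIn_of_adj hyC hxy.symm h)
    exact (not_le.mp hxT).trans_le (componentIn_subset (T := {x | g v ≤ g x}) hyC)

end SimpleGraph

namespace VorTiling

/-! ### Adjointness and the cut space -/

section Forms

variable {α : Type*} {β : Type*} {G : Graph α β}

/-- Reversal as a permutation of the oriented edges. -/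
def Dart.revEquiv (G : Graph α β) : Dart G ≃ Dart G :=
  ⟨Dart.rev, Dart.rev, fun _ => rfl, fun _ => rfl⟩

theorem C1.apply_rev {A : Type*} [CommRing A] (x : C1 G A) (a : Dart G) : x.1 a.rev = -x.1 a :=
  x.2 a

theorem d_apply {A : Type*} [CommRing A] (g : C0 G A) (a : Dart G) :
    (d G A g).1 a = g a.head - g a.tail := rfl

variable [Finite α] [Finite β]

theorem dStar_sub (x y : C1 G ℝ) : dStar G ℝ (x - y) = dStar G ℝ x - dStar G ℝ y := by
  ext v
  simp only [dStar, Pi.sub_apply, ← Finset.sum_sub_distrib]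
  refine Finset.sum_congr rfl fun a _ => ?_
  split_ifs <;> simp

/-- `d*` is adjoint to `d`. -/
theorem sum_mul_dStar [Fintype V(G)] (g : C0 G ℝ) (x : C1 G ℝ) :
    ∑ v, g v * dStar G ℝ x v = inner1 G x (d G ℝ g) := by
  classical
  have h1 : ∑ v, g v * dStar G ℝ x v = ∑ a : Dart G, x.1 a * g a.head := by
    simp only [dStar, Finset.mul_sum]
    rw [Finset.sum_comm]
    refine Finset.sum_congr rfl fun a _ => ?_
    simp [mul_comm]
  -- Reversing all edges; the two equal halves absorb the factor `1/2` of `inner1`.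
  have h2 : ∑ a : Dart G, x.1 a * g a.tail = -∑ a : Dart G, x.1 a * g a.head := by
    rw [← (Dart.revEquiv G).sum_comp, ← Finset.sum_neg_distrib]
    refine Finset.sum_congr rfl fun a _ => ?_
    change x.1 a.rev * g a.head = _
    rw [C1.apply_rev, neg_mul]
  simp only [inner1, d_apply, mul_sub, Finset.sum_sub_distrib]
  rw [h1, h2]
  ring

theorem functional_dStar (l : C0 G ℝ →ₗ[ℝ] ℝ) [DecidableEq V(G)] (x : C1 G ℝ) :
    l (dStar G ℝ x) = inner1 G x (d G ℝ fun v => l (Pi.single v 1)) := by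
  have := Fintype.ofFinite V(G)
  rw [← sum_mul_dStar, l.pi_apply_eq_sum_univ]
  refine Finset.sum_congr rfl fun v _ => ?_
  rw [smul_eq_mul, mul_comm]
  congr 2
  ext w
  simp [Pi.single_apply, eq_comm]

theorem inner1_d_eq_of_dStar_eq {x y : C1 G ℝ} (h : dStar G ℝ x = dStar G ℝ y) (g : C0 G ℝ) :
    inner1 G x (d G ℝ g) = inner1 G y (d G ℝ g) := by
  have := Fintype.ofFinite V(G)
  rw [← sum_mul_dStar, ← sum_mul_dStar, h]

variable (G) in
/-- The scalar product `inner1` as a bilinear form. -/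
noncomputable def innerForm : LinearMap.BilinForm ℝ (C1 G ℝ) :=
  LinearMap.mk₂ ℝ (inner1 G)
    (fun x y z => by simp [inner1, add_mul, Finset.sum_add_distrib, mul_add])
    (fun c x y => by simp [inner1, mul_assoc, mul_left_comm c, Finset.mul_sum])
    (fun x y z => by simp [inner1, Finset.sum_add_distrib, mul_add])
    (fun c x y => by simp [inner1, ← Finset.mul_sum, mul_left_comm _ c])

theorem inner1_comm (x y : C1 G ℝ) : inner1 G x y = inner1 G y x := by
  simp [inner1, mul_comm]

theorem eq_zero_of_inner1_self {x : C1 G ℝ} (h : inner1 G x x = 0) : x = 0 := by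
  have h0 : ∑ a : Dart G, x.1 a * x.1 a = 0 := by
    simpa [inner1] using h
  rw [Finset.sum_eq_zero_iff_of_nonneg fun a _ => mul_self_nonneg _] at h0
  ext a
  simpa using h0 a (Finset.mem_univ a)

/-- Every value of `d*` is attained on the cut space. -/
theorem exists_mem_cutSpace_dStar_eq (x : C1 G ℝ) :
    ∃ y ∈ cutSpace G, dStar G ℝ y = dStar G ℝ x := by
  classical
  have hrefl : (innerForm G).IsRefl := fun y z h => (inner1_comm z y).trans h
  have hdisj : Disjoint (cutSpace G) ((innerForm G).orthogonal (cutSpace G)) := by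
    rw [Submodule.disjoint_def]
    exact fun y hy hy' => eq_zero_of_inner1_self (hy' y hy)
  have hc := ((innerForm G).isCompl_orthogonal_iff_disjoint hrefl).mpr hdisj
  -- Project to the cut space: `d*` kills its orthogonal complement.
  have hx : x ∈ cutSpace G ⊔ (innerForm G).orthogonal (cutSpace G) := by
    rw [hc.sup_eq_top]
    trivial
  obtain ⟨y, hy, z, hz, rfl⟩ := Submodule.mem_sup.mp hx
  refine ⟨y, hy, ?_⟩
  have := Fintype.ofFinite V(G)
  have hz0 : dStar G ℝ z = 0 := by
    ext v
    have h1 : inner1 G z (d G ℝ (Pi.single v 1)) = 0 :=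
      (inner1_comm _ _).trans (hz _ ⟨_, rfl⟩)
    rw [← sum_mul_dStar] at h1
    simpa [Pi.single_apply] using h1
  have := dStar_sub (y + z) z
  rw [hz0, add_sub_cancel_right, sub_zero] at this
  exact this

end Forms

/-! ### Floors, cubes and exposed faces -/

section Faces

variable {α : Type*} {β : Type*} {G : Graph α β} {ℓ : β → ℕ} {m : C1 G ℤ}

theorem mem_edgeSet_subgraph {f : C0 G ℤ} (a : Dart G) :
    a.edge ∈ E(subgraph G ℓ m f) ↔ (ℓ a.edge : ℤ) ∣ f a.head - f a.tail + m.1 a := by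
  have hE : a.edge ∈ E(G) := a.isLink.edge_mem
  simp only [subgraph, Graph.edgeSet_restrict, Set.mem_inter_iff, hE, true_and,
    Set.mem_ofPred_eq]
  refine ⟨?_, fun h => ⟨a, rfl, h⟩⟩
  rintro ⟨b, hb, h⟩
  have hl := b.isLink
  rw [hb] at hl
  rcases a.isLink.eq_and_eq_or_eq_and_eq hl with ⟨h1, h2⟩ | ⟨h1, h2⟩
  · obtain rfl : a = b := Dart.ext hb.symm h1 h2
    exact h
  · obtain rfl : b = a.rev := Dart.ext hb h2.symm h1.symm
    rw [C1.apply_rev, Dart.head_rev, Dart.tail_rev] at h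
    rw [← dvd_neg]
    have e : -(f a.head - f a.tail + m.1 a) = f a.tail - f a.head + -m.1 a := by ring
    rw [e]
    exact h

theorem mul_delta_le (hℓ : ∀ e ∈ E(G), 0 < ℓ e) (f : C0 G ℤ) (a : Dart G) :
    (ℓ a.edge : ℤ) * delta G ℓ m f a ≤ f a.head - f a.tail + m.1 a := by
  have hpos : (0 : ℝ) < ℓ a.edge := by exact_mod_cast hℓ _ a.isLink.edge_mem
  have h := Int.floor_le (((f a.head - f a.tail + m.1 a : ℤ) : ℝ) / (ℓ a.edge : ℝ))
  rw [le_div_iff₀ hpos, mul_comm] at h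
  rw [delta]
  exact Int.cast_le (R := ℝ).mp (by rw [Int.cast_mul, Int.cast_natCast]; exact h)

theorem lt_mul_delta_add_one (hℓ : ∀ e ∈ E(G), 0 < ℓ e) (f : C0 G ℤ) (a : Dart G) :
    f a.head - f a.tail + m.1 a < (ℓ a.edge : ℤ) * (delta G ℓ m f a + 1) := by
  have hpos : (0 : ℝ) < ℓ a.edge := by exact_mod_cast hℓ _ a.isLink.edge_mem
  have h := Int.lt_floor_add_one (((f a.head - f a.tail + m.1 a : ℤ) : ℝ) / (ℓ a.edge : ℝ))
  rw [div_lt_iff₀ hpos, mul_comm] at h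
  rw [delta]
  refine Int.cast_lt (R := ℝ).mp ?_
  push_cast at h ⊢
  exact h

theorem mul_delta_rev_le (hℓ : ∀ e ∈ E(G), 0 < ℓ e) (f : C0 G ℤ) (a : Dart G) :
    (ℓ a.edge : ℤ) * delta G ℓ m f a.rev ≤ -(f a.head - f a.tail + m.1 a) := by
  have h := mul_delta_le (m := m) hℓ f a.rev
  rw [C1.apply_rev, Dart.head_rev, Dart.tail_rev] at h
  exact h.trans_eq (by ring)

/-- The two fractions under the floors have negative sum, and the sum of the floors is an integer.
This is what separates the two cubes. -/
theorem delta_add_delta_rev_le (hℓ : ∀ e ∈ E(G), 0 < ℓ e) {f₁ f₂ : C0 G ℤ} {a : Dart G}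
    (h : (f₂ - f₁) a.tail < (f₂ - f₁) a.head) :
    delta G ℓ m f₁ a + delta G ℓ m f₂ a.rev ≤ -1 := by
  have hpos : (0 : ℤ) < ℓ a.edge := by exact_mod_cast hℓ _ a.isLink.edge_mem
  have h1 := mul_delta_le (m := m) hℓ f₁ a
  have h2 := mul_delta_rev_le (m := m) hℓ f₂ a
  simp only [Pi.sub_apply] at h
  have h3 : (ℓ a.edge : ℤ) * (delta G ℓ m f₁ a + delta G ℓ m f₂ a.rev) < ℓ a.edge * 0 := by
    rw [mul_add]
    linarith
  have := lt_of_mul_lt_mul_left h3 hpos.le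
  omega

theorem delta_mono (hℓ : ∀ e ∈ E(G), 0 < ℓ e) {f₁ f₂ : C0 G ℤ} {a : Dart G}
    (h : (f₂ - f₁) a.tail ≤ (f₂ - f₁) a.head) : delta G ℓ m f₁ a ≤ delta G ℓ m f₂ a := by
  have hpos : (0 : ℤ) < ℓ a.edge := by exact_mod_cast hℓ _ a.isLink.edge_mem
  have h1 := mul_delta_le (m := m) hℓ f₁ a
  have h2 := lt_mul_delta_add_one (m := m) hℓ f₂ a
  simp only [Pi.sub_apply] at h
  have := lt_of_mul_lt_mul_left
    (show (ℓ a.edge : ℤ) * delta G ℓ m f₁ a < ℓ a.edge * (delta G ℓ m f₂ a + 1) by linarith) hpos.le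
  omega

theorem delta_rev_of_mem (hℓ : ∀ e ∈ E(G), 0 < ℓ e) {f : C0 G ℤ} {a : Dart G}
    (h : a.edge ∈ E(subgraph G ℓ m f)) : delta G ℓ m f a.rev = -delta G ℓ m f a := by
  have hpos : (0 : ℤ) < ℓ a.edge := by exact_mod_cast hℓ _ a.isLink.edge_mem
  obtain ⟨k, hk⟩ := (mem_edgeSet_subgraph a).mp h
  have h1 := mul_delta_le (m := m) hℓ f a
  have h2 := lt_mul_delta_add_one (m := m) hℓ f a
  have h3 := mul_delta_rev_le (m := m) hℓ f a
  have h4 := lt_mul_delta_add_one (m := m) hℓ f a.rev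
  rw [C1.apply_rev, Dart.head_rev, Dart.tail_rev] at h4
  have h4' : (ℓ a.edge : ℤ) * -k < ℓ a.edge * (delta G ℓ m f a.rev + 1) := by
    refine lt_of_eq_of_lt ?_ h4
    linarith
  rw [hk] at h1 h2 h3
  rw [← mul_neg] at h3
  have h1 := le_of_mul_le_mul_left h1 hpos
  have h2 := lt_of_mul_lt_mul_left h2 hpos.le
  have h3 := le_of_mul_le_mul_left h3 hpos
  have h4 := lt_of_mul_lt_mul_left h4' hpos.le
  omega

theorem delta_rev_of_notMem (hℓ : ∀ e ∈ E(G), 0 < ℓ e) {f : C0 G ℤ} {a : Dart G}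
    (h : a.edge ∉ E(subgraph G ℓ m f)) : delta G ℓ m f a.rev = -delta G ℓ m f a - 1 := by
  have hpos : (0 : ℤ) < ℓ a.edge := by exact_mod_cast hℓ _ a.isLink.edge_mem
  rw [mem_edgeSet_subgraph] at h
  have h1 := lt_of_le_of_ne (mul_delta_le (m := m) hℓ f a) fun h' => h ⟨_, h'.symm⟩
  have h2 := lt_mul_delta_add_one (m := m) hℓ f a
  have h3 := mul_delta_rev_le (m := m) hℓ f a
  have h4 := lt_mul_delta_add_one (m := m) hℓ f a.rev
  rw [C1.apply_rev, Dart.head_rev, Dart.tail_rev] at h4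
  have h5 : (ℓ a.edge : ℤ) * (delta G ℓ m f a + delta G ℓ m f a.rev) < ℓ a.edge * 0 := by
    rw [mul_add]
    linarith
  have h6 : (ℓ a.edge : ℤ) * 0 <
      ℓ a.edge * ((delta G ℓ m f a + 1) + (delta G ℓ m f a.rev + 1)) := by
    rw [mul_add _ (delta G ℓ m f a + 1)]
    have : (ℓ a.rev.edge : ℤ) = ℓ a.edge := rfl
    rw [this] at h4
    linarith
  have h5 := lt_of_mul_lt_mul_left h5 hpos.le
  have h6 := lt_of_mul_lt_mul_left h6 hpos.le
  omega

theorem dPoint_apply (f : C0 G ℤ) (a : Dart G) :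
    (dPoint G ℓ m f).1 a = (1 / 2) * ((delta G ℓ m f a : ℝ) - (delta G ℓ m f a.rev : ℝ)) := rfl

theorem dPoint_of_mem (hℓ : ∀ e ∈ E(G), 0 < ℓ e) {f : C0 G ℤ} {a : Dart G}
    (h : a.edge ∈ E(subgraph G ℓ m f)) : (dPoint G ℓ m f).1 a = delta G ℓ m f a := by
  rw [dPoint_apply, delta_rev_of_mem hℓ h]
  push_cast
  ring

theorem dPoint_of_notMem (hℓ : ∀ e ∈ E(G), 0 < ℓ e) {f : C0 G ℤ} {a : Dart G}
    (h : a.edge ∉ E(subgraph G ℓ m f)) :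
    (dPoint G ℓ m f).1 a = delta G ℓ m f a + 1 / 2 := by
  rw [dPoint_apply, delta_rev_of_notMem hℓ h]
  push_cast
  ring

/-- The cube is cut out by upper bounds on the coordinates. -/
theorem mem_cube_iff (hℓ : ∀ e ∈ E(G), 0 < ℓ e) {f : C0 G ℤ} {x : C1 G ℝ} :
    x ∈ cube G ℓ m f ↔ ∀ a, x.1 a ≤ delta G ℓ m f a + 1 / 2 := by
  constructor
  · rintro ⟨ε, h1, h2, rfl⟩ a
    change (dPoint G ℓ m f).1 a + ε.1 a ≤ _
    by_cases ha : a.edge ∈ E(subgraph G ℓ m f)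
    · rw [dPoint_of_mem hℓ ha]
      linarith [(abs_le.mp (h1 a)).2]
    · rw [dPoint_of_notMem hℓ ha, h2 a ha, add_zero]
  · intro h
    have hsub : ∀ a, (x - dPoint G ℓ m f).1 a = x.1 a - (dPoint G ℓ m f).1 a := fun _ => rfl
    -- The bound at `ā` is a lower bound at `a`; off the subgraph it equals the upper bound, pinning
    -- the coordinate.
    have key : ∀ a, -delta G ℓ m f a.rev - 1 / 2 ≤ x.1 a := fun a => by
      have := h a.rev
      rw [C1.apply_rev] at this
      linarith
    refine ⟨x - dPoint G ℓ m f, fun a => ?_, fun a ha => ?_, by simp⟩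
    · have h1 := h a
      have h2 := key a
      rw [hsub, abs_le]
      by_cases ha : a.edge ∈ E(subgraph G ℓ m f)
      · rw [dPoint_of_mem hℓ ha]
        rw [delta_rev_of_mem hℓ ha] at h2
        push_cast at h2
        constructor <;> linarith
      · rw [dPoint_of_notMem hℓ ha]
        rw [delta_rev_of_notMem hℓ ha] at h2
        push_cast at h2
        constructor <;> linarith
    · have h1 := h a
      have h2 := key a
      rw [hsub, dPoint_of_notMem hℓ ha]
      rw [delta_rev_of_notMem hℓ ha] at h2
      push_cast at h2
      linarith

/-- The point of the cube determined by the signs of `d(g)`. -/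
noncomputable def extremePoint (G : Graph α β) (ℓ : β → ℕ) (m : C1 G ℤ) (f : C0 G ℤ)
    (g : C0 G ℝ) : C1 G ℝ :=
  dPoint G ℓ m f + (1 / 2 : ℝ) • chi G ℓ m f (coherentOrientation (subgraph G ℓ m f) g)

theorem mem_image_ofLE_coherentOrientation {f : C0 G ℤ} {g : C0 G ℝ} {a : Dart G} :
    a ∈ Dart.ofLE (subgraph_le G ℓ m f) '' coherentOrientation (subgraph G ℓ m f) g ↔
      a.edge ∈ E(subgraph G ℓ m f) ∧ g a.tail < g a.head := by
  constructor
  · rintro ⟨b, hb, rfl⟩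
    exact ⟨b.isLink.edge_mem, hb⟩
  · rintro ⟨h1, h2⟩
    exact ⟨⟨a.edge, a.fst, a.snd, h1.2, a.isLink⟩, h2, rfl⟩

theorem extremePoint_apply (f : C0 G ℤ) (g : C0 G ℝ) (a : Dart G) :
    (extremePoint G ℓ m f g).1 a = (dPoint G ℓ m f).1 a + (1 / 2) * (chi G ℓ m f
      (coherentOrientation (subgraph G ℓ m f) g)).1 a := rfl

open Classical in
theorem chi_apply (f : C0 G ℤ) (D : Set (Dart (subgraph G ℓ m f))) (a : Dart G) :
    (chi G ℓ m f D).1 a = (if a ∈ Dart.ofLE (subgraph_le G ℓ m f) '' D then 1 else 0) -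
      (if a.rev ∈ Dart.ofLE (subgraph_le G ℓ m f) '' D then 1 else 0) := rfl

/-- The `1/2` comes from `chi` on the subgraph and is already part of `dPoint` off it. -/
theorem extremePoint_of_lt (hℓ : ∀ e ∈ E(G), 0 < ℓ e) {f : C0 G ℤ} {g : C0 G ℝ} {a : Dart G}
    (h : g a.tail < g a.head) : (extremePoint G ℓ m f g).1 a = delta G ℓ m f a + 1 / 2 := by
  have hrev := mt (mem_image_ofLE_coherentOrientation (ℓ := ℓ) (m := m) (f := f) (a := a.rev)).mp
    fun h' => h.not_gt h'.2
  rw [extremePoint_apply, chi_apply, if_neg hrev]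
  by_cases ha : a.edge ∈ E(subgraph G ℓ m f)
  · rw [if_pos (mem_image_ofLE_coherentOrientation.mpr ⟨ha, h⟩), dPoint_of_mem hℓ ha, sub_zero,
      mul_one]
  · rw [if_neg (fun h' => ha (mem_image_ofLE_coherentOrientation.mp h').1),
      dPoint_of_notMem hℓ ha, sub_zero, mul_zero, add_zero]

theorem extremePoint_of_eq {f : C0 G ℤ} {g : C0 G ℝ} {a : Dart G}
    (h : g a.tail = g a.head) : (extremePoint G ℓ m f g).1 a = (dPoint G ℓ m f).1 a := by
  have h1 := mt (mem_image_ofLE_coherentOrientation (ℓ := ℓ) (m := m) (f := f) (a := a)).mp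
    fun h' => h.not_lt h'.2
  have h2 := mt (mem_image_ofLE_coherentOrientation (ℓ := ℓ) (m := m) (f := f) (a := a.rev)).mp
    fun h' => h.not_gt h'.2
  rw [extremePoint_apply, chi_apply, if_neg h1, if_neg h2, sub_zero, mul_zero, add_zero]

theorem extremePoint_of_gt (hℓ : ∀ e ∈ E(G), 0 < ℓ e) {f : C0 G ℤ} {g : C0 G ℝ} {a : Dart G}
    (h : g a.head < g a.tail) :
    (extremePoint G ℓ m f g).1 a = -delta G ℓ m f a.rev - 1 / 2 := by
  have h1 := extremePoint_of_lt (m := m) (f := f) (g := g) (a := a.rev) hℓ h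
  rw [C1.apply_rev] at h1
  linarith

theorem dPoint_le (hℓ : ∀ e ∈ E(G), 0 < ℓ e) (f : C0 G ℤ) (a : Dart G) :
    (dPoint G ℓ m f).1 a ≤ delta G ℓ m f a + 1 / 2 := by
  by_cases ha : a.edge ∈ E(subgraph G ℓ m f)
  · rw [dPoint_of_mem hℓ ha]
    linarith
  · rw [dPoint_of_notMem hℓ ha]

theorem extremePoint_mem_cube (hℓ : ∀ e ∈ E(G), 0 < ℓ e) (f : C0 G ℤ) (g : C0 G ℝ) :
    extremePoint G ℓ m f g ∈ cube G ℓ m f := by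
  rw [mem_cube_iff hℓ]
  intro a
  rcases lt_trichotomy (g a.tail) (g a.head) with h | h | h
  · exact (extremePoint_of_lt hℓ h).le
  · rw [extremePoint_of_eq h]
    exact dPoint_le hℓ f a
  · rw [extremePoint_of_gt hℓ h]
    have := dPoint_le (m := m) hℓ f a
    rw [dPoint_apply] at this
    linarith

theorem mul_d_le_of_forall_eq (hℓ : ∀ e ∈ E(G), 0 < ℓ e) {f : C0 G ℤ} {g : C0 G ℝ} {x y : C1 G ℝ}
    (hx : ∀ a : Dart G, g a.tail < g a.head → x.1 a = delta G ℓ m f a + 1 / 2)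
    (hy : y ∈ cube G ℓ m f) (a : Dart G) : y.1 a * (d G ℝ g).1 a ≤ x.1 a * (d G ℝ g).1 a := by
  rw [mem_cube_iff hℓ] at hy
  rw [d_apply]
  rcases lt_trichotomy (g a.tail) (g a.head) with h | h | h
  · exact mul_le_mul_of_nonneg_right ((hy a).trans_eq (hx a h).symm) (sub_pos.mpr h).le
  · simp [h]
  · refine mul_le_mul_of_nonpos_right ?_ (sub_neg.mpr h).le
    have h1 := hx a.rev h
    have h2 := hy a.rev
    rw [C1.apply_rev] at h1 h2
    linarith

variable [Finite α] [Finite β]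

/-- The face of the polytope on which the functional with coefficients `g` is maximal. -/
def faceSet (G : Graph α β) (ℓ : β → ℕ) (m : C1 G ℤ) (f : C0 G ℤ) (g : C0 G ℝ) :
    Set (C0 G ℝ) :=
  dStar G ℝ '' {x ∈ cube G ℓ m f |
    ∀ a : Dart G, g a.tail < g a.head → x.1 a = delta G ℓ m f a + 1 / 2}

theorem dStar_extremePoint_mem_faceSet (hℓ : ∀ e ∈ E(G), 0 < ℓ e) (f : C0 G ℤ) (g : C0 G ℝ) :
    dStar G ℝ (extremePoint G ℓ m f g) ∈ faceSet G ℓ m f g :=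
  ⟨_, ⟨extremePoint_mem_cube hℓ f g, fun _ h => extremePoint_of_lt hℓ h⟩, rfl⟩

/-- The extreme point of `g` dominates every cube point term by term, so a maximiser must match it
in each term with `d g ≠ 0`. -/
theorem setOf_maximal_eq_faceSet (hℓ : ∀ e ∈ E(G), 0 < ℓ e) (f : C0 G ℤ) (g : C0 G ℝ)
    (l : C0 G ℝ → ℝ) (hl : ∀ x, l (dStar G ℝ x) = inner1 G x (d G ℝ g)) :
    {x ∈ vor G ℓ m f | ∀ y ∈ vor G ℓ m f, l y ≤ l x} = faceSet G ℓ m f g := by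
  ext z
  constructor
  · rintro ⟨⟨x, hx, rfl⟩, hmax⟩
    refine ⟨x, ⟨hx, fun a ha => ?_⟩, rfl⟩
    have h1 := hmax _ ⟨_, extremePoint_mem_cube hℓ f g, rfl⟩
    rw [hl, hl, inner1, inner1] at h1
    have hle : ∀ a ∈ (Finset.univ : Finset (Dart G)), x.1 a * (d G ℝ g).1 a ≤
        (extremePoint G ℓ m f g).1 a * (d G ℝ g).1 a :=
      fun a _ => mul_d_le_of_forall_eq hℓ (fun _ h => extremePoint_of_lt hℓ h) hx a
    have heq := (Finset.sum_eq_sum_iff_of_le hle).mp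
      (le_antisymm (Finset.sum_le_sum hle) (by linarith)) a (Finset.mem_univ a)
    rw [extremePoint_of_lt hℓ ha, d_apply] at heq
    exact mul_right_cancel₀ (sub_pos.mpr ha).ne' heq
  · rintro ⟨x, ⟨hx, hx'⟩, rfl⟩
    refine ⟨⟨x, hx, rfl⟩, ?_⟩
    rintro _ ⟨y, hy, rfl⟩
    rw [hl, hl, inner1, inner1]
    exact mul_le_mul_of_nonneg_left
      (Finset.sum_le_sum fun a _ => mul_d_le_of_forall_eq hℓ hx' hy a) (by norm_num)

theorem isExposed_faceSet (hℓ : ∀ e ∈ E(G), 0 < ℓ e) (f : C0 G ℤ) (g : C0 G ℝ) :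
    IsExposed ℝ (vor G ℓ m f) (faceSet G ℓ m f g) := by
  intro _
  have := Fintype.ofFinite V(G)
  refine ⟨∑ v, g v • ContinuousLinearMap.proj v,
    (setOf_maximal_eq_faceSet hℓ f g _ fun x => ?_).symm⟩
  rw [← sum_mul_dStar]
  simp

theorem exists_eq_faceSet_of_isExposed (hℓ : ∀ e ∈ E(G), 0 < ℓ e) {f : C0 G ℤ}
    {F : Set (C0 G ℝ)} (hF : IsExposed ℝ (vor G ℓ m f) F) (hne : F.Nonempty) :
    ∃ g, F = faceSet G ℓ m f g := by
  classical
  obtain ⟨l, rfl⟩ := hF hne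
  exact ⟨_, setOf_maximal_eq_faceSet hℓ f _ l (functional_dStar l.toLinearMap)⟩

end Faces

/-! ### Faces and their orientations -/

section Orientation

variable {α : Type*} {β : Type*} {G : Graph α β} {ℓ : β → ℕ} {m : C1 G ℤ} {f : C0 G ℤ}

theorem Dart.ofLE_injective {G' G : Graph α β} (h : G' ≤ G) :
    Function.Injective (Dart.ofLE h) := fun _ _ h' =>
  Dart.ext (congrArg Dart.edge h' :) (congrArg Dart.fst h' :) (congrArg Dart.snd h' :)

/-- Restriction of `1`-cochains to the subgraph. -/
def restrictC1 (G : Graph α β) (ℓ : β → ℕ) (m : C1 G ℤ) (f : C0 G ℤ) (x : C1 G ℝ) :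
    C1 (subgraph G ℓ m f) ℝ :=
  ⟨fun a => x.1 (a.ofLE (subgraph_le G ℓ m f)), fun a => x.2 (a.ofLE (subgraph_le G ℓ m f))⟩

theorem d_indicator_trichotomy (S : Set V(G)) (a : Dart G) :
    ((d G ℝ (S.indicator fun _ => 1)).1 a = 1 ∧ a.tail ∉ S ∧ a.head ∈ S) ∨
      (d G ℝ (S.indicator fun _ => 1)).1 a = 0 ∨
      ((d G ℝ (S.indicator fun _ => 1)).1 a = -1 ∧ a.tail ∈ S ∧ a.head ∉ S) := by
  by_cases h1 : a.tail ∈ S <;> by_cases h2 : a.head ∈ S <;> simp [d_apply, h1, h2]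

theorem sub_dPoint_apply (hℓ : ∀ e ∈ E(G), 0 < ℓ e) (x : C1 G ℝ) (a : Dart (subgraph G ℓ m f)) :
    (restrictC1 G ℓ m f (x - dPoint G ℓ m f)).1 a =
      x.1 (a.ofLE (subgraph_le G ℓ m f)) - delta G ℓ m f (a.ofLE (subgraph_le G ℓ m f)) := by
  have h : (a.ofLE (subgraph_le G ℓ m f)).edge ∈ E(subgraph G ℓ m f) := a.isLink.edge_mem
  rw [← dPoint_of_mem hℓ h]
  rfl

variable [Finite α] [Finite β]

theorem dStar_restrictC1 {x : C1 G ℝ} (hx : ∀ a, a.edge ∉ E(subgraph G ℓ m f) → x.1 a = 0)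
    (v : V(G)) : dStar (subgraph G ℓ m f) ℝ (restrictC1 G ℓ m f x) v = dStar G ℝ x v := by
  refine Fintype.sum_of_injective (Dart.ofLE (subgraph_le G ℓ m f)) (Dart.ofLE_injective _) _ _
    (fun a ha => ?_) (fun a => ?_)
  · rw [hx, ite_self]
    exact fun h => ha ⟨⟨a.edge, a.fst, a.snd, h.2, a.isLink⟩, rfl⟩
  · rfl

/-- Pairing with a coboundary depends only on the image under `d*`, so the hyperplane equation may
be tested on `x - dPoint` itself, without projecting it to the cut space. -/
theorem dStar_mem_vorHyperplane_iff {x : C1 G ℝ} (hx : x ∈ cube G ℓ m f)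
    (g : C0 (subgraph G ℓ m f) ℝ) :
    dStar G ℝ x ∈ vorHyperplane G ℓ m f (d (subgraph G ℓ m f) ℝ g) ↔
      2 * inner1 _ (restrictC1 G ℓ m f (x - dPoint G ℓ m f)) (d (subgraph G ℓ m f) ℝ g) =
        inner1 _ (d (subgraph G ℓ m f) ℝ g) (d (subgraph G ℓ m f) ℝ g) := by
  have hsupp : ∀ a, a.edge ∉ E(subgraph G ℓ m f) → (x - dPoint G ℓ m f).1 a = 0 := by
    obtain ⟨ε, -, h, rfl⟩ := hx
    intro a ha
    rw [add_sub_cancel_left]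
    exact h a ha
  have hstar : ∀ v, dStar G ℝ x v = dStar G ℝ (dPoint G ℓ m f) v +
      dStar (subgraph G ℓ m f) ℝ (restrictC1 G ℓ m f (x - dPoint G ℓ m f)) v := by
    intro v
    rw [dStar_restrictC1 hsupp, dStar_sub, Pi.sub_apply]
    ring
  constructor
  · rintro ⟨y, ⟨-, hy⟩, h⟩
    rw [← hy]
    congr 1
    refine inner1_d_eq_of_dStar_eq (funext fun v => ?_) g
    exact (add_left_cancel ((congrFun h v).trans (hstar v))).symm
  · intro h
    obtain ⟨y, hy, hy'⟩ := exists_mem_cutSpace_dStar_eq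
      (restrictC1 G ℓ m f (x - dPoint G ℓ m f))
    refine ⟨y, ⟨hy, ?_⟩, funext fun v => ?_⟩
    · rw [inner1_d_eq_of_dStar_eq hy', h]
    · rw [hstar]
      exact congrArg (dStar G ℝ (dPoint G ℓ m f) v + ·) (congrFun hy' v)

/-- A face lies in the hyperplane of a cut exactly when the cut is directed compatibly. -/
theorem faceSet_subset_vorHyperplane_iff (hℓ : ∀ e ∈ E(G), 0 < ℓ e) (g : C0 G ℝ)
    (S : Set V(subgraph G ℓ m f)) :
    faceSet G ℓ m f g ⊆
        vorHyperplane G ℓ m f (d (subgraph G ℓ m f) ℝ (S.indicator fun _ => 1)) ↔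
      ∀ a : Dart (subgraph G ℓ m f), a.tail ∉ S → a.head ∈ S →
        g a.tail < g a.head := by
  set b := d (subgraph G ℓ m f) ℝ (S.indicator fun _ => 1) with hb
  have htri : ∀ a, (b.1 a = 1 ∧ a.tail ∉ S ∧ a.head ∈ S) ∨ b.1 a = 0 ∨
      (b.1 a = -1 ∧ a.tail ∈ S ∧ a.head ∉ S) := d_indicator_trichotomy S
  constructor
  · intro h a ha1 ha2
    have hz := h (dStar_extremePoint_mem_faceSet hℓ f g)
    replace hz := (dStar_mem_vorHyperplane_iff (extremePoint_mem_cube hℓ f g) _).mp hz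
    rw [← hb, inner1, inner1] at hz
    set ε := restrictC1 G ℓ m f (extremePoint G ℓ m f g - dPoint G ℓ m f) with hε
    have hup : ∀ a, ε.1 a ≤ 1 / 2 := fun a => by
      rw [hε, sub_dPoint_apply hℓ]
      have := (mem_cube_iff (m := m) hℓ).mp (extremePoint_mem_cube hℓ f g)
        (a.ofLE (subgraph_le G ℓ m f))
      linarith
    -- Since `|ε| ≤ 1/2` and `b ∈ {0, ±1}`, the hyperplane equation is an equality case and forces
    -- `ε = 1/2` where `b = 1`. The extreme point has `ε ≤ 0` where `g` does not increase.
    have hle : ∀ a ∈ (Finset.univ : Finset (Dart (subgraph G ℓ m f))),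
        2 * (ε.1 a * b.1 a) ≤ b.1 a * b.1 a := by
      intro a _
      have h1 := hup a
      have h2 := hup a.rev
      rw [C1.apply_rev] at h2
      rcases htri a with ⟨h, -⟩ | h | ⟨h, -⟩ <;> rw [h] <;> linarith
    have heq := (Finset.sum_eq_sum_iff_of_le hle).mp
      (by rw [← Finset.mul_sum]; linarith) a (Finset.mem_univ a)
    have hba : b.1 a = 1 := by
      rcases htri a with h | h | h
      · exact h.1
      · rw [hb, d_apply, Set.indicator_of_mem ha2, Set.indicator_of_notMem ha1] at h
        norm_num at h
      · exact absurd h.2.1 ha1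
    rw [hba, hε, sub_dPoint_apply hℓ] at heq
    by_contra hlt
    have hle : (extremePoint G ℓ m f g).1 (a.ofLE (subgraph_le G ℓ m f)) ≤
        delta G ℓ m f (a.ofLE (subgraph_le G ℓ m f)) := by
      have hE : (a.ofLE (subgraph_le G ℓ m f)).edge ∈ E(subgraph G ℓ m f) := a.isLink.edge_mem
      rcases (not_lt.mp hlt).lt_or_eq with h' | h'
      · rw [extremePoint_of_gt hℓ (a := a.ofLE (subgraph_le G ℓ m f)) h',
          delta_rev_of_mem hℓ hE]
        push_cast
        linarith
      · rw [extremePoint_of_eq (a := a.ofLE (subgraph_le G ℓ m f)) h'.symm,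
          dPoint_of_mem hℓ hE]
    linarith
  · rintro h _ ⟨x, ⟨hx, hx'⟩, rfl⟩
    refine (dStar_mem_vorHyperplane_iff hx _).mpr ?_
    rw [← hb, inner1, inner1, mul_left_comm, Finset.mul_sum]
    congr 1
    refine Finset.sum_congr rfl fun a _ => ?_
    have hval : ∀ a : Dart (subgraph G ℓ m f), a.tail ∉ S → a.head ∈ S →
        (restrictC1 G ℓ m f (x - dPoint G ℓ m f)).1 a = 1 / 2 := fun a h1 h2 => by
      rw [sub_dPoint_apply hℓ, hx' (a.ofLE (subgraph_le G ℓ m f)) (h a h1 h2)]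
      ring
    rcases htri a with ⟨h0, h1, h2⟩ | h0 | ⟨h0, h1, h2⟩
    · rw [h0, hval a h1 h2]
      norm_num
    · rw [h0]
      norm_num
    · have := hval a.rev h2 h1
      rw [C1.apply_rev] at this
      rw [h0]
      linarith

theorem faceOrientation_faceSet (hℓ : ∀ e ∈ E(G), 0 < ℓ e)
    (hconn : Connected (subgraph G ℓ m f)) (g : C0 G ℝ) :
    faceOrientation G ℓ m f (faceSet G ℓ m f g) =
      coherentOrientation (subgraph G ℓ m f) g := by
  ext a
  simp only [faceOrientation, Set.mem_iUnion, exists_prop, Set.mem_ofPred_eq]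
  constructor
  · rintro ⟨b, ⟨⟨S, -, -, rfl⟩, hF⟩, ha⟩
    have ha : 0 < (d (subgraph G ℓ m f) ℝ (S.indicator fun _ => 1)).1 a := ha
    rcases d_indicator_trichotomy S a with ⟨-, h1, h2⟩ | h | ⟨h, -⟩
    · exact (faceSet_subset_vorHyperplane_iff hℓ g S).mp hF a h1 h2
    · rw [h] at ha
      exact absurd ha (lt_irrefl _)
    · rw [h] at ha
      norm_num at ha
  · intro ha
    have ha : g a.tail < g a.head := ha
    obtain ⟨S, h1, h2, h3, h4, h5⟩ := SimpleGraph.exists_increasing_bond hconn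
      (g : V(subgraph G ℓ m f) → ℝ) ha
    refine ⟨_, ⟨⟨S, h1, h2, rfl⟩, (faceSet_subset_vorHyperplane_iff hℓ g S).mpr
      fun c hc1 hc2 => h5 _ _ ⟨fun h => hc1 (h ▸ hc2), c.edge, c.isLink⟩ hc1 hc2⟩, ?_⟩
    change 0 < (d (subgraph G ℓ m f) ℝ (S.indicator fun _ => 1)).1 a
    rw [d_apply, Set.indicator_of_mem h4, Set.indicator_of_notMem h3]
    norm_num

/-- Off the subgraph the coordinates of cube points are fixed at the bound, so only the orientation
on the subgraph imposes conditions. -/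
theorem faceSet_congr (hℓ : ∀ e ∈ E(G), 0 < ℓ e) {g h : C0 G ℝ}
    (hgh : coherentOrientation (subgraph G ℓ m f) g = coherentOrientation (subgraph G ℓ m f) h) :
    faceSet G ℓ m f g = faceSet G ℓ m f h := by
  have key : ∀ {g h : C0 G ℝ}, coherentOrientation (subgraph G ℓ m f) g =
      coherentOrientation (subgraph G ℓ m f) h → faceSet G ℓ m f g ⊆ faceSet G ℓ m f h := by
    rintro g h hgh _ ⟨x, ⟨hx, hx'⟩, rfl⟩
    refine ⟨x, ⟨hx, fun a ha => ?_⟩, rfl⟩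
    by_cases hE : a.edge ∈ E(subgraph G ℓ m f)
    · have hmem := mem_image_ofLE_coherentOrientation.mpr ⟨hE, ha⟩
      rw [← hgh] at hmem
      exact hx' a (mem_image_ofLE_coherentOrientation.mp hmem).2
    · obtain ⟨ε, -, hε, rfl⟩ := hx
      change (dPoint G ℓ m f).1 a + ε.1 a = _
      rw [hε a hE, add_zero, dPoint_of_notMem hℓ hE]
  exact (key hgh).antisymm (key hgh.symm)

theorem isFaceOf_iff (hℓ : ∀ e ∈ E(G), 0 < ℓ e) (hconn : Connected (subgraph G ℓ m f))
    (g : C0 G ℝ) (F : Set (C0 G ℝ)) :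
    IsFaceOf G ℓ m f (coherentOrientation (subgraph G ℓ m f) g) F ↔ F = faceSet G ℓ m f g := by
  constructor
  · rintro ⟨hne, hexp, hF⟩
    obtain ⟨h, rfl⟩ := exists_eq_faceSet_of_isExposed hℓ hexp hne
    rw [faceOrientation_faceSet hℓ hconn] at hF
    exact faceSet_congr hℓ hF
  · rintro rfl
    exact ⟨⟨_, dStar_extremePoint_mem_faceSet hℓ f g⟩, isExposed_faceSet hℓ f g,
      faceOrientation_faceSet hℓ hconn g⟩

end Orientation

/-! ### Intersection of two polytopes -/

section Intersection

variable {α : Type*} {β : Type*} {G : Graph α β} {ℓ : β → ℕ} {m : C1 G ℤ} {f₁ f₂ : C0 G ℤ}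

/-- The difference `f₂ - f₁` with real values. -/
def realDiff (f₁ f₂ : C0 G ℤ) : C0 G ℝ := fun v => ((f₂ - f₁) v : ℤ)

theorem realDiff_lt_iff {u v : V(G)} :
    realDiff f₁ f₂ u < realDiff f₁ f₂ v ↔ (f₂ - f₁) u < (f₂ - f₁) v := Int.cast_lt

theorem realDiff_swap_lt_iff {u v : V(G)} :
    realDiff f₂ f₁ u < realDiff f₂ f₁ v ↔ realDiff f₁ f₂ v < realDiff f₁ f₂ u := by
  rw [realDiff_lt_iff, realDiff_lt_iff]
  simp only [Pi.sub_apply]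
  omega

theorem orientationIncr_eq : orientationIncr G ℓ m f₁ f₂ =
    coherentOrientation (subgraph G ℓ m f₁) (realDiff f₁ f₂) :=
  Set.ext fun _ => realDiff_lt_iff.symm

theorem orientationDecr_eq : orientationDecr G ℓ m f₁ f₂ =
    coherentOrientation (subgraph G ℓ m f₂) (realDiff f₂ f₁) :=
  Set.ext fun _ => (realDiff_swap_lt_iff.trans realDiff_lt_iff).symm

theorem delta_eq_of_diff_eq {a : Dart G} (h : (f₂ - f₁) a.tail = (f₂ - f₁) a.head) :
    delta G ℓ m f₁ a = delta G ℓ m f₂ a := by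
  have : f₁ a.head - f₁ a.tail + m.1 a = f₂ a.head - f₂ a.tail + m.1 a := by
    simp only [Pi.sub_apply] at h
    linarith
  rw [delta, delta, this]

/-- Where `f₂ - f₁` is constant the two floors agree, so only the edges along which it varies
matter. -/
theorem extremePoint_eq_iff (hℓ : ∀ e ∈ E(G), 0 < ℓ e) :
    extremePoint G ℓ m f₁ (realDiff f₁ f₂) = extremePoint G ℓ m f₂ (realDiff f₂ f₁) ↔
      ∀ a : Dart G, (f₂ - f₁) a.tail < (f₂ - f₁) a.head →
        delta G ℓ m f₁ a + delta G ℓ m f₂ a.rev = -1 := by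
  constructor
  · intro h a ha
    have ha' := realDiff_lt_iff.mpr ha
    have h1 : (extremePoint G ℓ m f₁ (realDiff f₁ f₂)).1 a =
        (extremePoint G ℓ m f₂ (realDiff f₂ f₁)).1 a := by rw [h]
    rw [extremePoint_of_lt hℓ ha', extremePoint_of_gt hℓ (realDiff_swap_lt_iff.mpr ha')] at h1
    have : ((delta G ℓ m f₁ a + delta G ℓ m f₂ a.rev : ℤ) : ℝ) = (-1 : ℤ) := by
      push_cast
      linarith
    exact_mod_cast this
  · intro h
    have key : ∀ a : Dart G, (f₂ - f₁) a.tail < (f₂ - f₁) a.head →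
        (extremePoint G ℓ m f₁ (realDiff f₁ f₂)).1 a =
          (extremePoint G ℓ m f₂ (realDiff f₂ f₁)).1 a := fun a ha => by
      have ha' := realDiff_lt_iff.mpr ha
      rw [extremePoint_of_lt hℓ ha', extremePoint_of_gt hℓ (realDiff_swap_lt_iff.mpr ha')]
      have : ((delta G ℓ m f₁ a + delta G ℓ m f₂ a.rev : ℤ) : ℝ) = (-1 : ℤ) := by rw [h a ha]
      push_cast at this
      linarith
    refine Subtype.ext (funext fun a => ?_)
    rcases lt_trichotomy ((f₂ - f₁) a.tail) ((f₂ - f₁) a.head) with ha | ha | ha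
    · exact key a ha
    · have e1 : realDiff f₁ f₂ a.tail = realDiff f₁ f₂ a.head := congrArg Int.cast ha
      have e2 : realDiff f₂ f₁ a.tail = realDiff f₂ f₁ a.head := by
        simp only [realDiff, Pi.sub_apply] at e1 ⊢
        push_cast at e1 ⊢
        linarith
      rw [extremePoint_of_eq e1, extremePoint_of_eq e2, dPoint_apply, dPoint_apply,
        delta_eq_of_diff_eq ha, delta_eq_of_diff_eq (a := a.rev) ha.symm]
    · have := key a.rev ha
      rw [C1.apply_rev, C1.apply_rev] at this
      exact neg_injective this

variable [Finite α] [Finite β]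

/-- Two points of the cubes with the same image agree, and are extremal, on the edges along which
`f₂ - f₁` increases. -/
theorem eq_delta_of_dStar_eq (hℓ : ∀ e ∈ E(G), 0 < ℓ e) {x y : C1 G ℝ}
    (hx : x ∈ cube G ℓ m f₁) (hy : y ∈ cube G ℓ m f₂) (hxy : dStar G ℝ x = dStar G ℝ y)
    {a : Dart G} (ha : (f₂ - f₁) a.tail < (f₂ - f₁) a.head) :
    x.1 a = delta G ℓ m f₁ a + 1 / 2 ∧ delta G ℓ m f₁ a + delta G ℓ m f₂ a.rev = -1 := by
  rw [mem_cube_iff hℓ] at hx hy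
  have hchain : ∀ a : Dart G, (f₂ - f₁) a.tail < (f₂ - f₁) a.head →
      x.1 a ≤ delta G ℓ m f₁ a + 1 / 2 ∧
      (delta G ℓ m f₁ a + 1 / 2 : ℝ) ≤ -delta G ℓ m f₂ a.rev - 1 / 2 ∧
      -delta G ℓ m f₂ a.rev - 1 / 2 ≤ y.1 a := fun a ha => by
    have h1 : ((delta G ℓ m f₁ a + delta G ℓ m f₂ a.rev : ℤ) : ℝ) ≤ (-1 : ℤ) :=
      Int.cast_le.mpr (delta_add_delta_rev_le hℓ ha)
    have h2 := hy a.rev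
    rw [C1.apply_rev] at h2
    push_cast at h1
    exact ⟨hx a, by linarith, by linarith⟩
  have hle : ∀ a ∈ (Finset.univ : Finset (Dart G)),
      x.1 a * (d G ℝ (realDiff f₁ f₂)).1 a ≤ y.1 a * (d G ℝ (realDiff f₁ f₂)).1 a := by
    intro a _
    rw [d_apply]
    rcases lt_trichotomy ((f₂ - f₁) a.tail) ((f₂ - f₁) a.head) with h | h | h
    · obtain ⟨h1, h2, h3⟩ := hchain a h
      exact mul_le_mul_of_nonneg_right (by linarith) (sub_pos.mpr (realDiff_lt_iff.mpr h)).le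
    · simp [realDiff, h]
    · obtain ⟨h1, h2, h3⟩ := hchain a.rev h
      rw [C1.apply_rev] at h1 h3
      exact mul_le_mul_of_nonpos_right (by linarith) (sub_neg.mpr (realDiff_lt_iff.mpr h)).le
  have hsum := inner1_d_eq_of_dStar_eq hxy (realDiff f₁ f₂)
  rw [inner1, inner1] at hsum
  -- Termwise inequalities with equal sums: the whole chain `hchain` collapses.
  have heq := (Finset.sum_eq_sum_iff_of_le hle).mp (by linarith) a (Finset.mem_univ a)
  have heq := mul_right_cancel₀ (sub_pos.mpr (realDiff_lt_iff.mpr ha)).ne' heq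
  obtain ⟨h1, h2, h3⟩ := hchain a ha
  refine ⟨by linarith, ?_⟩
  have : ((delta G ℓ m f₁ a + delta G ℓ m f₂ a.rev : ℤ) : ℝ) = (-1 : ℤ) := by
    push_cast
    linarith
  exact_mod_cast this

theorem vor_inter_vor_nonempty_iff (hℓ : ∀ e ∈ E(G), 0 < ℓ e) :
    (vor G ℓ m f₁ ∩ vor G ℓ m f₂).Nonempty ↔
      extremePoint G ℓ m f₁ (realDiff f₁ f₂) = extremePoint G ℓ m f₂ (realDiff f₂ f₁) := by
  constructor
  · rintro ⟨_, ⟨x, hx, rfl⟩, y, hy, hxy⟩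
    exact (extremePoint_eq_iff hℓ).mpr fun a ha => (eq_delta_of_dStar_eq hℓ hx hy hxy.symm ha).2
  · intro h
    exact ⟨_, ⟨_, extremePoint_mem_cube hℓ f₁ _, rfl⟩, _, extremePoint_mem_cube hℓ f₂ _,
      congrArg _ h.symm⟩

theorem vor_inter_vor_eq_faceSet (hℓ : ∀ e ∈ E(G), 0 < ℓ e)
    (hne : (vor G ℓ m f₁ ∩ vor G ℓ m f₂).Nonempty) :
    vor G ℓ m f₁ ∩ vor G ℓ m f₂ = faceSet G ℓ m f₁ (realDiff f₁ f₂) := by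
  have htight := (extremePoint_eq_iff hℓ).mp ((vor_inter_vor_nonempty_iff hℓ).mp hne)
  ext z
  constructor
  · rintro ⟨⟨x, hx, rfl⟩, y, hy, hxy⟩
    exact ⟨x, ⟨hx, fun a ha =>
      (eq_delta_of_dStar_eq hℓ hx hy hxy.symm (realDiff_lt_iff.mp ha)).1⟩, rfl⟩
  · rintro ⟨x, ⟨hx, hx'⟩, rfl⟩
    -- The same cochain lies in the second cube: where `f₂ - f₁` does not decrease the bound only
    -- grows, and elsewhere `x` sits exactly on it by `htight`.
    refine ⟨⟨x, hx, rfl⟩, x, ?_, rfl⟩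
    rw [mem_cube_iff hℓ] at hx ⊢
    intro a
    rcases le_or_gt ((f₂ - f₁) a.tail) ((f₂ - f₁) a.head) with ha | ha
    · have : (delta G ℓ m f₁ a : ℝ) ≤ delta G ℓ m f₂ a := Int.cast_le.mpr (delta_mono hℓ ha)
      linarith [hx a]
    · have h1 := hx' a.rev (realDiff_lt_iff.mpr ha)
      have h2 : ((delta G ℓ m f₁ a.rev + delta G ℓ m f₂ a : ℤ) : ℝ) = (-1 : ℤ) :=
        congrArg Int.cast (htight a.rev ha)
      rw [C1.apply_rev] at h1
      push_cast at h2
      linarith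

end Intersection

end VorTiling

theorem mainTheorem7 {α : Type*} {β : Type*} [Finite α] [Finite β]
    (G : Graph α β) [G.Loopless] (ℓ : β → ℕ) (hℓ : ∀ e ∈ E(G), 0 < ℓ e)
    (m : VorTiling.C1 G ℤ) (f₁ f₂ : VorTiling.C0 G ℤ) :
    ((VorTiling.vor G ℓ m f₁ ∩ VorTiling.vor G ℓ m f₂).Nonempty ↔
      VorTiling.dPoint G ℓ m f₁ +
          (1 / 2 : ℝ) • VorTiling.chi G ℓ m f₁ (VorTiling.orientationIncr G ℓ m f₁ f₂) =
        VorTiling.dPoint G ℓ m f₂ +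
          (1 / 2 : ℝ) • VorTiling.chi G ℓ m f₂ (VorTiling.orientationDecr G ℓ m f₁ f₂)) ∧
    (VorTiling.Connected (VorTiling.subgraph G ℓ m f₁) →
      VorTiling.Connected (VorTiling.subgraph G ℓ m f₂) →
      (VorTiling.vor G ℓ m f₁ ∩ VorTiling.vor G ℓ m f₂).Nonempty →
      ∃ F₁ F₂ : Set (VorTiling.C0 G ℝ),
        (∀ F, VorTiling.IsFaceOf G ℓ m f₁ (VorTiling.orientationIncr G ℓ m f₁ f₂) F ↔ F = F₁) ∧
        (∀ F, VorTiling.IsFaceOf G ℓ m f₂ (VorTiling.orientationDecr G ℓ m f₁ f₂) F ↔ F = F₂) ∧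
        F₁ = F₂ ∧ F₂ = VorTiling.vor G ℓ m f₁ ∩ VorTiling.vor G ℓ m f₂) := by
  rw [VorTiling.orientationIncr_eq, VorTiling.orientationDecr_eq]
  refine ⟨VorTiling.vor_inter_vor_nonempty_iff hℓ, fun h₁ h₂ hne => ?_⟩
  have e₁ := VorTiling.vor_inter_vor_eq_faceSet hℓ hne
  have e₂ := VorTiling.vor_inter_vor_eq_faceSet hℓ (Set.inter_comm _ _ ▸ hne)
  rw [Set.inter_comm] at e₂
  exact ⟨_, _, VorTiling.isFaceOf_iff hℓ h₁ _, VorTiling.isFaceOf_iff hℓ h₂ _,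
    e₁.symm.trans e₂, e₂.symm⟩
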